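/- Let $(\Omega,\mathcal F,P)$ be a probability space, $n_0$ a dimension and $\rho\ge 0$. Let $(x_k)_{k\ge 0}$ be a process of square-integrable random vectors in $\mathbb R^{n_0}$ (not necessarily Gaussian), let $(w_k)_{k\ge 0}$ be a sequence of independent standard Gaussian random vectors in $\mathbb R^{n_0}$ (so $E[w_k]=0$ and $E[w_kw_l^T]=I\,\delta_{kl}$), and assume that the processes $(x_k)$ and $(w_k)$ are independent. Put $z_k=\sqrt{\rho}\,x_k+w_k$, $x^k=(x_0,\dots,x_k)$ and $z^k=(z_0,\dots,z_k)$. For $j\ge 0$ let $\hat x_{j|j-1}$ be the linear least-squares estimate of $x_j$ given $z_0,\dots,z_{j-1}$, that is, the componentwise orthogonal projection in $L^2(P)$ of $x_j$ onto the span of the constants and of the components of $z_0,\dots,z_{j-1}$ (so $\hat x_{0|-1}=E[x_0]$), and let $$M_j=E\big[(x_j-\hat x_{j|j-1})(x_j-\hat x_{j|j-1})^T\big]$$ be the covariance matrix of the one-step prediction error. Write $|A|$ for the determinant of $A$, $\log$ for the natural logarithm, and $I[X;Z]$ for the mutual information in nats, i.e. the Kullback–Leibler divergence of the joint law of $(X,Z)$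 from the product of its marginal laws. Then: (i) for every $j\ge 0$, $|I+\rho M_j|>0$ and $\log|I+\rho M_j|\le\rho\,\mathrm{tr}(M_j)$; (ii) for every $k\ge 0$, the mutual information $I[x^k;z^k]$ is finite and $$I[x^k;z^k]\;\le\;\frac12\sum_{j=0}^k\log|I+\rho M_j|\;\le\;\frac{\rho}{2}\sum_{j=0}^k\mathrm{tr}(M_j).$$ -/

import Mathlib

open MeasureTheory ProbabilityTheory

namespace InnovationsChannel

noncomputable section

variable {Ω : Type*} [MeasurableSpace Ω]

/-- The channel output `z_k = √ρ x_k + w_k`. -/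
def output {n : ℕ} (ρ : ℝ) (x w : ℕ → Ω → EuclideanSpace ℝ (Fin n)) :
    ℕ → Ω → EuclideanSpace ℝ (Fin n) :=
  fun k ω => Real.sqrt ρ • x k ω + w k ω

/-- The block `x^k = (x_0, …, x_k)` of a vector process, as one random variable. -/
def block {n : ℕ} (x : ℕ → Ω → EuclideanSpace ℝ (Fin n)) (k : ℕ) :
    Ω → (Fin (k + 1) → EuclideanSpace ℝ (Fin n)) :=
  fun ω j => x j ω

/-- The mutual information `I[X; Z]` in nats: the Kullback-Leibler divergence of the joint law
of `(X, Z)` from the product of the two marginal laws. -/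
def mutualInfo {A B : Type*} [MeasurableSpace A] [MeasurableSpace B]
    (P : Measure Ω) (X : Ω → A) (Z : Ω → B) : ENNReal :=
  InformationTheory.klDiv (P.map (fun ω => (X ω, Z ω))) ((P.map X).prod (P.map Z))

open Classical in
/-- The class in `L²(P)` of a square-integrable real random variable (`0` for other functions,
a value that is not used for the processes considered here). -/
def toL2 (P : Measure Ω) (f : Ω → ℝ) : Lp ℝ 2 P :=
  if h : MemLp f 2 P then h.toLp f else 0

/-- The constant `1` (index `none`) and the components `z_l^{(i)}`, `0 ≤ l ≤ k - 1`, of the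
observations strictly before time `k`, as elements of `L²(P)`. -/
def pastObservations {n : ℕ} (P : Measure Ω) (z : ℕ → Ω → EuclideanSpace ℝ (Fin n)) (k : ℕ) :
    Option (Fin k × Fin n) → Lp ℝ 2 P
  | none => toL2 P (fun _ => 1)
  | some (l, i) => toL2 P (fun ω => z l ω i)

/-- The `L²(P)`-space on which linear estimates from `z_0, …, z_{k-1}` are sought: the (finite
dimensional) span of the components of the observations and of the constants. -/
abbrev pastSpace {n : ℕ} (P : Measure Ω) (z : ℕ → Ω → EuclideanSpace ℝ (Fin n)) (k : ℕ) :
    Submodule ℝ (Lp ℝ 2 P) :=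
  Submodule.span ℝ (Set.range (pastObservations P z k))

instance finiteDimensional_pastSpace {n : ℕ} (P : Measure Ω) (z : ℕ → Ω → EuclideanSpace ℝ (Fin n)) (k : ℕ) :
    FiniteDimensional ℝ (pastSpace P z k) :=
  FiniteDimensional.span_of_finite ℝ (Set.finite_range _)

/-- The `i`-th component of the linear least-squares one-step prediction `x̂_{k|k-1}` of `x_k`
given `z_0, …, z_{k-1}`: the orthogonal projection of `x_k^{(i)}` onto the space spanned by the
past observations and the constants. -/
def prediction {n : ℕ} (P : Measure Ω) (x z : ℕ → Ω → EuclideanSpace ℝ (Fin n)) (k : ℕ)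
    (i : Fin n) : Lp ℝ 2 P :=
  (pastSpace P z k).starProjection (toL2 P (fun ω => x k ω i))

/-- The covariance matrix `M_k = E[(x_k - x̂_{k|k-1}) (x_k - x̂_{k|k-1})ᵀ]` of the one-step
prediction error. -/
def predictionErrorCov {n : ℕ} (P : Measure Ω) (x z : ℕ → Ω → EuclideanSpace ℝ (Fin n))
    (k : ℕ) : Matrix (Fin n) (Fin n) ℝ :=
  Matrix.of fun i i' =>
    ∫ ω, (x k ω i - prediction P x z k i ω) * (x k ω i' - prediction P x z k i' ω) ∂P

end

end InnovationsChannel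

/-! Mutual information is the minimum over laws `Q` of the divergence of the joint law of `(X, Z)`
from `P_X × Q`, so any trial output law `Q` gives an upper bound (`mutualInfo_le_klDiv_prod`). For
additive noise the log-likelihood ratio is the log-density of the noise at `W` minus that of `Q` at
`Z` (`mutualInfo_add_noise_le`).

Take for `Q` the Gaussian law under which the whitened innovations are standard normal. The ratio is
then quadratic, so its expectation depends on second moments only, and `x` need not be Gaussian.
Whitening makes the two quadratic terms cancel in expectation. What remains is the log-Jacobian of
the map from outputs to whitened innovations. Subtracting a causal predictor is unipotent, so only
the whitening blocks contribute, giving half the sum of the log-determinants of the innovation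
covariances (`mutualInfo_le_sum_log_det`).

These covariances are `1 + ρ M_j`, because the prediction error is orthogonal to the current noise
(`inner_innovation`). This uses only that the prediction lies in the past space, not that it is
optimal. The trace bound is `log t ≤ t - 1` on eigenvalues. -/

/-! ### Densities and log-likelihood ratios. -/

theorem pi_withDensity_ofReal {ι : Type*} [Fintype ι] {E : ι → Type*}
    [∀ i, MeasurableSpace (E i)] (μ : ∀ i, Measure (E i)) [∀ i, SigmaFinite (μ i)]
    {f : ∀ i, E i → ℝ} (hf : ∀ i, Integrable (f i) (μ i)) (h0 : ∀ i x, 0 ≤ f i x) :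
    Measure.pi (fun i => (μ i).withDensity (fun x => ENNReal.ofReal (f i x))) =
      (Measure.pi μ).withDensity (fun x => ENNReal.ofReal (∏ i, f i (x i))) := by
  have hfin : ∀ i, IsFiniteMeasure ((μ i).withDensity (fun x => ENNReal.ofReal (f i x))) :=
    fun i => isFiniteMeasure_withDensity_ofReal (hf i).2
  refine Measure.pi_eq fun s hs => ?_
  rw [withDensity_apply _ (MeasurableSet.univ_pi hs), Measure.restrict_pi_pi,
    ← ofReal_integral_eq_lintegral_ofReal
      (Integrable.fintype_prod_dep fun i => (hf i).restrict)
      (ae_of_all _ fun x => Finset.prod_nonneg fun i _ => h0 i _),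
    integral_fintype_prod_eq_prod, ENNReal.ofReal_prod_of_nonneg
      (fun i _ => integral_nonneg (h0 i))]
  refine Finset.prod_congr rfl fun i _ => ?_
  rw [withDensity_apply _ (hs i), ofReal_integral_eq_lintegral_ofReal (hf i).restrict
    (ae_of_all _ (h0 i))]

theorem MeasureTheory.MeasurePreserving.map_withDensity_comp {α β : Type*} [MeasurableSpace α]
    [MeasurableSpace β] {m : Measure α} {m' : Measure β} {T : α → β}
    (hT : MeasurePreserving T m m') {G : β → ENNReal} (hG : Measurable G) :
    (m.withDensity (fun a => G (T a))).map T = m'.withDensity G := by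
  ext s hs
  rw [Measure.map_apply hT.measurable hs, withDensity_apply _ (hT.measurable hs),
    withDensity_apply _ hs, ← hT.map_eq, setLIntegral_map hs hG hT.measurable]

theorem llr_withDensity_exp {α : Type*} [MeasurableSpace α] (ν : Measure α) [SigmaFinite ν]
    {l : α → ℝ} (hl : Measurable l) :
    llr (ν.withDensity (fun a => ENNReal.ofReal (Real.exp (l a)))) ν =ᵐ[ν] l := by
  filter_upwards [Measure.rnDeriv_withDensity ν
    (f := fun a => ENNReal.ofReal (Real.exp (l a))) (by fun_prop)] with a ha
  rw [llr, ha, ENNReal.toReal_ofReal (Real.exp_nonneg _), Real.log_exp]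

theorem withDensity_ofReal_exp_sub {α : Type*} [MeasurableSpace α] (m : Measure α)
    {f g : α → ℝ} (hf : Measurable f) (hg : Measurable g) :
    (m.withDensity (fun a => ENNReal.ofReal (Real.exp (g a)))).withDensity
      (fun a => ENNReal.ofReal (Real.exp (f a - g a))) =
      m.withDensity (fun a => ENNReal.ofReal (Real.exp (f a))) := by
  rw [← withDensity_mul _ (by fun_prop) (by fun_prop)]
  congr 1
  ext a
  rw [Pi.mul_apply, ← ENNReal.ofReal_mul (Real.exp_nonneg _), ← Real.exp_add]
  congr 2
  ring

/-! ### Mutual information against a trial output law. -/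

namespace InnovationsChannel

variable {Ω : Type*} [MeasurableSpace Ω]

open InformationTheory

/-- Replacing the marginal law of the output by another law can only increase the divergence. -/
theorem mutualInfo_le_klDiv_prod {A B : Type*} [MeasurableSpace A] [StandardBorelSpace A]
    [Nonempty A] [MeasurableSpace B] (P : Measure Ω) [IsProbabilityMeasure P]
    {X : Ω → A} {Z : Ω → B} (hX : Measurable X) (hZ : Measurable Z)
    (Q : Measure B) [IsProbabilityMeasure Q] :
    mutualInfo P X Z ≤ klDiv (P.map (fun ω => (X ω, Z ω))) ((P.map X).prod Q) := by
  have := Measure.isProbabilityMeasure_map (μ := P) hX.aemeasurable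
  have := Measure.isProbabilityMeasure_map (μ := P) hZ.aemeasurable
  -- By the chain rule the right side exceeds the left by the divergence of the law of `Z` from `Q`.
  -- The pair is swapped so that the disintegration is over `Z`, with kernel into the standard Borel
  -- space `A`.
  have key : klDiv (P.map (fun ω => (Z ω, X ω))) ((P.map Z).prod (P.map X)) ≤
      klDiv (P.map (fun ω => (Z ω, X ω))) (Q.prod (P.map X)) := by
    rw [← compProd_map_condDistrib hX.aemeasurable, ← Measure.compProd_const (μ := Q),
      ← Measure.compProd_const (μ := P.map Z),
      klDiv_compProd_eq_add (P.map Z) Q _ _]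
    exact le_add_self
  calc mutualInfo P X Z
      = klDiv ((P.map (fun ω => (Z ω, X ω))).map Prod.swap)
          (((P.map Z).prod (P.map X)).map Prod.swap) := by
        rw [Measure.map_map measurable_swap (hZ.prodMk hX), Measure.prod_swap]; rfl
    _ ≤ _ := klDiv_map_le _ _ measurable_swap
    _ ≤ _ := key
    _ = klDiv ((P.map (fun ω => (X ω, Z ω))).map Prod.swap)
          (((P.map X).prod Q).map Prod.swap) := by
        rw [Measure.map_map measurable_swap (hX.prodMk hZ), Measure.prod_swap]; rfl
    _ ≤ _ := klDiv_map_le _ _ measurable_swap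

/-- The shear `(a, v) ↦ (a, h a + v)` preserves `P_X × m` by translation invariance of `m`, so the
density of the independent pair `(X, W)` is merely transported along it. -/
theorem map_prodMk_add_eq_withDensity {A V : Type*} [MeasurableSpace A] [AddCommGroup V]
    [MeasurableSpace V] [MeasurableAdd₂ V] [MeasurableSub₂ V]
    (P : Measure Ω) [IsProbabilityMeasure P] (m : Measure V) [SigmaFinite m]
    [m.IsAddLeftInvariant] {X : Ω → A} {W : Ω → V} (hX : Measurable X) (hW : Measurable W)
    (hXW : IndepFun X W P) {h : A → V} (hh : Measurable h) {g : V → ENNReal}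
    (hg : Measurable g) (hlaw : P.map W = m.withDensity g) :
    P.map (fun ω => (X ω, h (X ω) + W ω)) =
      ((P.map X).prod m).withDensity (fun p => g (p.2 - h p.1)) := by
  have := Measure.isProbabilityMeasure_map (μ := P) hX.aemeasurable
  have := Measure.isProbabilityMeasure_map (μ := P) hW.aemeasurable
  have := hlaw ▸ this
  have hT : MeasurePreserving (fun p : A × V => (p.1, h p.1 + p.2))
      ((P.map X).prod m) ((P.map X).prod m) :=
    (MeasurePreserving.id _).skew_product (g := fun a v => h a + v)
      (by simp only [Function.uncurry_def]; fun_prop)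
      (ae_of_all _ fun a => (measurePreserving_add_left m (h a)).map_eq)
  have hjoint : P.map (fun ω => (X ω, W ω)) =
      ((P.map X).prod m).withDensity (fun p => g p.2) := by
    rw [(indepFun_iff_map_prod_eq_prod_map_map hX.aemeasurable hW.aemeasurable).1 hXW, hlaw,
      prod_withDensity_right hg]
  have hcomp : (fun ω => (X ω, h (X ω) + W ω)) =
      (fun p : A × V => (p.1, h p.1 + p.2)) ∘ (fun ω => (X ω, W ω)) := rfl
  rw [hcomp, ← Measure.map_map hT.measurable (hX.prodMk hW), hjoint]
  have := hT.map_withDensity_comp (G := fun p => g (p.2 - h p.1)) (by fun_prop)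
  simpa only [add_sub_cancel_left] using this

/-- The mutual information across an additive noise channel is bounded by the expected
log-likelihood ratio of the noise against any reference law of the output. -/
theorem mutualInfo_add_noise_le {A V : Type*} [MeasurableSpace A] [StandardBorelSpace A]
    [Nonempty A] [AddCommGroup V] [MeasurableSpace V] [MeasurableAdd₂ V] [MeasurableSub₂ V]
    (P : Measure Ω) [IsProbabilityMeasure P] (m : Measure V) [SigmaFinite m]
    [m.IsAddLeftInvariant] {X : Ω → A} {W : Ω → V} (hX : Measurable X) (hW : Measurable W)
    (hXW : IndepFun X W P) {h : A → V} (hh : Measurable h) {f g : V → ℝ}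
    (hf : Measurable f) (hg : Measurable g)
    (hlaw : P.map W = m.withDensity (fun v => ENNReal.ofReal (Real.exp (f v))))
    [IsProbabilityMeasure (m.withDensity (fun v => ENNReal.ofReal (Real.exp (g v))))]
    (hint : Integrable (fun ω => f (W ω) - g (h (X ω) + W ω)) P) :
    mutualInfo P X (fun ω => h (X ω) + W ω) ≠ ⊤ ∧
      (mutualInfo P X (fun ω => h (X ω) + W ω)).toReal ≤
        ∫ ω, (f (W ω) - g (h (X ω) + W ω)) ∂P := by
  set Q := m.withDensity (fun v => ENNReal.ofReal (Real.exp (g v))) with hQ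
  have hZ : Measurable (fun ω => h (X ω) + W ω) := (hh.comp hX).add hW
  have := Measure.isProbabilityMeasure_map (μ := P) hX.aemeasurable
  set μ := P.map (fun ω => (X ω, h (X ω) + W ω)) with hμ
  have : IsProbabilityMeasure μ := Measure.isProbabilityMeasure_map (hX.prodMk hZ).aemeasurable
  set ν := (P.map X).prod Q with hν
  let l : A × V → ℝ := fun p => f (p.2 - h p.1) - g p.2
  have hl : Measurable l := by fun_prop
  -- Both measures have densities with respect to `P_X × m`; the one of `ν` is positive, so the
  -- quotient is the exponential of the difference of exponents.
  have hdens : μ = ν.withDensity (fun p => ENNReal.ofReal (Real.exp (l p))) := by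
    rw [hμ, map_prodMk_add_eq_withDensity P m hX hW hXW hh (by fun_prop) hlaw, hν, hQ,
      prod_withDensity_right (by fun_prop),
      withDensity_ofReal_exp_sub _ (f := fun p : A × V => f (p.2 - h p.1))
        (g := fun p : A × V => g p.2) (by fun_prop) (by fun_prop)]
  have hac : μ ≪ ν := hdens ▸ withDensity_absolutelyContinuous _ _
  have hllr : llr μ ν =ᵐ[μ] l := by
    refine hac.ae_eq ?_
    rw [hdens]
    exact llr_withDensity_exp ν hl
  have hlcomp : (fun ω => l (X ω, h (X ω) + W ω)) =
      fun ω => f (W ω) - g (h (X ω) + W ω) := by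
    ext ω; simp [l]
  have hli : Integrable l μ := by
    rw [hμ, integrable_map_measure hl.aestronglyMeasurable (hX.prodMk hZ).aemeasurable]
    simpa only [Function.comp_def, hlcomp] using hint
  have hne : klDiv μ ν ≠ ⊤ := klDiv_ne_top hac (hli.congr hllr.symm)
  have hle := mutualInfo_le_klDiv_prod P hX hZ Q
  refine ⟨ne_top_of_le_ne_top hne hle, (ENNReal.toReal_mono hne hle).trans_eq ?_⟩
  rw [toReal_klDiv_of_measure_eq hac (by simp), integral_congr_ae hllr, hμ,
    integral_map (hX.prodMk hZ).aemeasurable hl.aestronglyMeasurable, hlcomp]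

end InnovationsChannel

/-! ### Gaussian densities and affine changes of variables. -/

/-- The normalising constant is left unspecified: noise and trial law share it, and it cancels in
the log-likelihood ratio. -/
theorem exists_stdGaussian_eq_withDensity (ι : Type*) [Fintype ι] :
    ∃ C : ℝ, stdGaussian (EuclideanSpace ℝ ι) =
      volume.withDensity (fun v => ENNReal.ofReal (Real.exp (-‖v‖ ^ 2 / 2 - C))) := by
  refine ⟨Fintype.card ι * Real.log √(2 * Real.pi), ?_⟩
  have hpdf : ∀ x : ℝ, gaussianPDFReal 0 1 x =
      Real.exp (-x ^ 2 / 2 - Real.log √(2 * Real.pi)) := fun x => by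
    rw [gaussianPDFReal, Real.exp_sub, Real.exp_log (by positivity)]
    simp [div_eq_inv_mul]
  have hprod : ∀ v : EuclideanSpace ℝ ι, ∏ i, gaussianPDFReal 0 1 (v.ofLp i) =
      Real.exp (-‖v‖ ^ 2 / 2 - Fintype.card ι * Real.log √(2 * Real.pi)) := fun v => by
    simp only [hpdf, ← Real.exp_sum, Finset.sum_sub_distrib, Finset.sum_const, Finset.card_univ,
      nsmul_eq_mul, ← Finset.sum_div, Finset.sum_neg_distrib, EuclideanSpace.real_norm_sq_eq]
  rw [← map_pi_eq_stdGaussian, gaussianReal_of_var_ne_zero _ one_ne_zero]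
  simp only [gaussianPDF_def]
  rw [pi_withDensity_ofReal _ (fun _ => integrable_gaussianPDFReal 0 1)
    (fun _ => gaussianPDFReal_nonneg 0 1)]
  have := (PiLp.volume_preserving_toLp ι).map_withDensity_comp
    (G := fun v => ENNReal.ofReal (∏ i, gaussianPDFReal 0 1 (v.ofLp i))) (by fun_prop)
  simp only [hprod] at this
  rw [← this]
  simp only [← hprod]
  rfl

theorem exists_pi_stdGaussian_eq_withDensity (κ ι : Type*) [Fintype κ] [Fintype ι] :
    ∃ C : ℝ, Measure.pi (fun _ : κ => stdGaussian (EuclideanSpace ℝ ι)) =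
      volume.withDensity
        (fun v => ENNReal.ofReal (Real.exp (-(∑ j, ‖v j‖ ^ 2) / 2 - C))) := by
  obtain ⟨C, hC⟩ := exists_stdGaussian_eq_withDensity ι
  refine ⟨Fintype.card κ * C, ?_⟩
  have hint : Integrable (fun v : EuclideanSpace ℝ ι => Real.exp (-‖v‖ ^ 2 / 2 - C)) := by
    refine ⟨by fun_prop, ?_⟩
    rw [hasFiniteIntegral_iff_ofReal (ae_of_all _ fun v => Real.exp_nonneg _),
      ← setLIntegral_univ, ← withDensity_apply _ MeasurableSet.univ, ← hC]
    exact measure_lt_top _ _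
  rw [hC, pi_withDensity_ofReal _ (fun _ => hint) (fun _ _ => Real.exp_nonneg _)]
  simp only [← Real.exp_sum, Finset.sum_sub_distrib, Finset.sum_const, Finset.card_univ,
    nsmul_eq_mul, ← Finset.sum_div, Finset.sum_neg_distrib]
  rfl

/-- Change of variables: the added logarithm is the log-Jacobian. This is the law of a vector whose
image under `v ↦ L v + b` has density `exp f`. -/
theorem isProbabilityMeasure_withDensity_comp_affine {V : Type*} [NormedAddCommGroup V]
    [NormedSpace ℝ V] [MeasurableSpace V] [BorelSpace V] [FiniteDimensional ℝ V]
    (m : Measure V) [m.IsAddHaarMeasure] {f : V → ℝ} (hf : Measurable f)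
    [h1 : IsProbabilityMeasure (m.withDensity (fun v => ENNReal.ofReal (Real.exp (f v))))]
    (L : V →ₗ[ℝ] V) (hL : LinearMap.det L ≠ 0) (b : V) :
    IsProbabilityMeasure (m.withDensity (fun v => ENNReal.ofReal
      (Real.exp (f (L v + b) + Real.log |LinearMap.det L|)))) := by
  have h2 := h1.measure_univ
  have hLm : Measurable L := L.continuous_of_finiteDimensional.measurable
  refine ⟨?_⟩
  rw [withDensity_apply _ MeasurableSet.univ, setLIntegral_univ] at h2 ⊢
  have h3 : ∀ v, ENNReal.ofReal (Real.exp (f (L v + b) + Real.log |LinearMap.det L|)) =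
      ENNReal.ofReal |LinearMap.det L| * ENNReal.ofReal (Real.exp (f (L v + b))) := fun v => by
    rw [← ENNReal.ofReal_mul (abs_nonneg _), Real.exp_add, Real.exp_log (abs_pos.2 hL), mul_comm]
  simp only [h3]
  rw [lintegral_const_mul _ (by fun_prop),
    ← lintegral_map (f := fun v => ENNReal.ofReal (Real.exp (f (v + b)))) (by fun_prop) hLm,
    Measure.map_linearMap_addHaar_eq_smul_addHaar m hL, lintegral_smul_measure,
    lintegral_add_right_eq_self (fun v => ENNReal.ofReal (Real.exp (f v))) b, h2, smul_eq_mul,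
    mul_one, ← ENNReal.ofReal_mul (abs_nonneg _), abs_inv, mul_inv_cancel₀ (abs_ne_zero.2 hL),
    ENNReal.ofReal_one]

/-! ### Causal maps, whitening and quadratic forms. -/

/-- The characteristic polynomial of a nilpotent map is a power of `X`; evaluate it at `1`. -/
theorem det_one_sub_eq_one_of_isNilpotent {R M : Type*} [CommRing R] [IsDomain R]
    [AddCommGroup M] [Module R M] [Module.Free R M] [Module.Finite R M] {A : Module.End R M}
    (hA : IsNilpotent A) : LinearMap.det (1 - A) = 1 := by
  have h := LinearMap.eval_charpoly A (1 : R)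
  rw [hA.charpoly_eq_X_pow_finrank] at h
  simpa using h.symm

/-- Each application of `A` makes one more initial block vanish, so `A ^ K = 0`. -/
theorem isNilpotent_of_strictly_causal {K : ℕ} {R E : Type*} [CommRing R] [AddCommGroup E]
    [Module R E] (A : Module.End R (Fin K → E))
    (hA : ∀ z j, (∀ l < j, z l = 0) → A z j = 0) : IsNilpotent A := by
  refine ⟨K, ?_⟩
  have key : ∀ m z (j : Fin K), (j : ℕ) < m → (A ^ m) z j = 0 := by
    intro m
    induction m with
    | zero => intro z j hj; omega
    | succ m ih =>
      intro z j hj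
      rw [pow_succ']
      exact hA _ _ fun l hl => ih z l (by have := Fin.lt_def.1 hl; omega)
  exact LinearMap.ext fun z => funext fun j => key K z j j.2

open scoped Matrix MatrixOrder in
-- Factor `S⁻¹ = Bᵀ B`: cyclicity of the trace and multiplicativity of the determinant give the
-- rest.
theorem Matrix.PosDef.exists_whitening {ι : Type*} [Fintype ι] [DecidableEq ι]
    {S : Matrix ι ι ℝ} (hS : S.PosDef) :
    ∃ B : Matrix ι ι ℝ, (B * S * Bᵀ).trace = Fintype.card ι ∧ B.det ≠ 0 ∧
      Real.log |B.det| = -(1 / 2) * Real.log S.det := by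
  obtain ⟨B, hB⟩ := CStarAlgebra.nonneg_iff_eq_star_mul_self.mp hS.inv.posSemidef.nonneg
  have hB' : S⁻¹ = Bᵀ * B := by simpa [Matrix.star_eq_conjTranspose] using hB
  have hdet : B.det * B.det = S.det⁻¹ := by
    rw [← Ring.inverse_eq_inv', ← Matrix.det_nonsing_inv, hB', Matrix.det_mul,
      Matrix.det_transpose]
  have hpos := hS.det_pos
  have hne : B.det ≠ 0 := fun h => hpos.ne (by simpa [h] using hdet)
  refine ⟨B, ?_, hne, ?_⟩
  · rw [Matrix.trace_mul_comm, ← Matrix.mul_assoc, ← hB',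
      Matrix.nonsing_inv_mul _ (isUnit_iff_ne_zero.2 hpos.ne'), Matrix.trace_one]
  · have h := congrArg Real.log hdet
    rw [Real.log_mul hne hne, Real.log_inv] at h
    rw [Real.log_abs]
    linarith

theorem Matrix.PosDef.log_det_le_trace_sub_card {ι : Type*} [Fintype ι] [DecidableEq ι]
    {S : Matrix ι ι ℝ} (hS : S.PosDef) : Real.log S.det ≤ S.trace - Fintype.card ι := by
  rw [hS.isHermitian.det_eq_prod_eigenvalues, hS.isHermitian.trace_eq_sum_eigenvalues]
  simp only [RCLike.ofReal_real_eq_id, id]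
  rw [Real.log_prod (fun i _ => (hS.eigenvalues_pos i).ne')]
  calc _ ≤ ∑ i, (hS.isHermitian.eigenvalues i - 1) :=
        Finset.sum_le_sum fun i _ => Real.log_le_sub_one_of_pos (hS.eigenvalues_pos i)
    _ = _ := by simp

open scoped Matrix in
theorem integral_norm_sq_toLpLin {Ω ι : Type*} [MeasurableSpace Ω] [Fintype ι] [DecidableEq ι]
    (P : Measure Ω) {U : Ω → EuclideanSpace ℝ ι} {S : Matrix ι ι ℝ}
    (hU : ∀ i, MemLp (fun ω => U ω i) 2 P)
    (hS : ∀ i i', ∫ ω, U ω i * U ω i' ∂P = S i i') (B : Matrix ι ι ℝ) :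
    Integrable (fun ω => ‖Matrix.toLpLin 2 2 B (U ω)‖ ^ 2) P ∧
      ∫ ω, ‖Matrix.toLpLin 2 2 B (U ω)‖ ^ 2 ∂P = (B * S * Bᵀ).trace := by
  have h1 : ∀ ω, ‖Matrix.toLpLin 2 2 B (U ω)‖ ^ 2 =
      ∑ i, ∑ a, ∑ b, B i a * B i b * (U ω a * U ω b) := fun ω => by
    rw [EuclideanSpace.real_norm_sq_eq]
    refine Finset.sum_congr rfl fun i _ => ?_
    rw [Matrix.toLpLin_apply, sq]
    simp only [Matrix.mulVec, dotProduct, Finset.sum_mul_sum]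
    refine Finset.sum_congr rfl fun a _ => Finset.sum_congr rfl fun b _ => by ring
  have h2 : ∀ i a b, Integrable (fun ω => B i a * B i b * (U ω a * U ω b)) P :=
    fun i a b => ((hU a).integrable_mul (hU b)).const_mul _
  have h3 : ∀ i a, Integrable (fun ω => ∑ b, B i a * B i b * (U ω a * U ω b)) P :=
    fun i a => integrable_finsetSum _ fun b _ => h2 i a b
  have h4 : ∀ i, Integrable (fun ω => ∑ a, ∑ b, B i a * B i b * (U ω a * U ω b)) P :=
    fun i => integrable_finsetSum _ fun a _ => h3 i a
  simp only [h1]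
  refine ⟨integrable_finsetSum _ fun i _ => h4 i, ?_⟩
  rw [integral_finsetSum _ fun i _ => h4 i]
  simp only [Matrix.trace, Matrix.diag, Matrix.mul_apply, Matrix.transpose_apply]
  refine Finset.sum_congr rfl fun i _ => ?_
  rw [integral_finsetSum _ fun a _ => h3 i a]
  simp only [integral_finsetSum _ fun b _ => h2 i _ b, integral_const_mul, hS, Finset.sum_mul]
  rw [Finset.sum_comm]
  refine Finset.sum_congr rfl fun a _ => Finset.sum_congr rfl fun b _ => by ring

/-! ### The bound for a causal affine predictor. -/

namespace InnovationsChannel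

variable {Ω : Type*} [MeasurableSpace Ω]

/-- The mutual information across a Gaussian channel is at most half the sum of the
log-determinants of the covariances of the residuals of any causal affine predictor of the
output. -/
theorem mutualInfo_le_sum_log_det {K n : ℕ} {A : Type*} [MeasurableSpace A]
    [StandardBorelSpace A] [Nonempty A] (P : Measure Ω) [IsProbabilityMeasure P]
    {X : Ω → A} {W : Ω → Fin K → EuclideanSpace ℝ (Fin n)} (hX : Measurable X)
    (hW : Measurable W) (hXW : IndepFun X W P)
    (hlaw : P.map W = Measure.pi (fun _ => stdGaussian (EuclideanSpace ℝ (Fin n))))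
    (hW2 : ∀ j i, MemLp (fun ω => W ω j i) 2 P)
    (hWcov : ∀ j i i', ∫ ω, W ω j i * W ω j i' ∂P = (1 : Matrix (Fin n) (Fin n) ℝ) i i')
    {h : A → Fin K → EuclideanSpace ℝ (Fin n)} (hh : Measurable h)
    (T : Module.End ℝ (Fin K → EuclideanSpace ℝ (Fin n)))
    (hT : ∀ z j, (∀ l < j, z l = 0) → T z j = 0)
    (b : Fin K → EuclideanSpace ℝ (Fin n)) {S : Fin K → Matrix (Fin n) (Fin n) ℝ}
    (hS : ∀ j, (S j).PosDef) {U : Ω → Fin K → EuclideanSpace ℝ (Fin n)}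
    (hUdef : ∀ ω, U ω = h (X ω) + W ω - T (h (X ω) + W ω) - b)
    (hU2 : ∀ j i, MemLp (fun ω => U ω j i) 2 P)
    (hUcov : ∀ j i i', ∫ ω, U ω j i * U ω j i' ∂P = S j i i') :
    mutualInfo P X (fun ω => h (X ω) + W ω) ≠ ⊤ ∧
      (mutualInfo P X (fun ω => h (X ω) + W ω)).toReal ≤
        (1 / 2) * ∑ j, Real.log (S j).det := by
  choose B hBtr hBdet hBlog using fun j => (hS j).exists_whitening
  obtain ⟨C, hC⟩ := exists_pi_stdGaussian_eq_withDensity (Fin K) (Fin n)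
  let D : Module.End ℝ (Fin K → EuclideanSpace ℝ (Fin n)) :=
    LinearMap.pi fun j => (Matrix.toLpLin 2 2 (B j)).comp (LinearMap.proj j)
  let L := D ∘ₗ (1 - T)
  have hdet : LinearMap.det L = ∏ j, (B j).det := by
    rw [LinearMap.det_comp, det_one_sub_eq_one_of_isNilpotent (isNilpotent_of_strictly_causal T hT),
      mul_one, LinearMap.det_pi]
    simp only [LinearMap.det_toLpLin]
  have hdet0 : LinearMap.det L ≠ 0 := hdet ▸ Finset.prod_ne_zero_iff.2 fun j _ => hBdet j
  have hlogdet : Real.log |LinearMap.det L| = -(1 / 2) * ∑ j, Real.log (S j).det := by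
    rw [hdet, Finset.abs_prod, Real.log_prod (fun j _ => abs_ne_zero.2 (hBdet j)),
      Finset.mul_sum]
    exact Finset.sum_congr rfl fun j _ => hBlog j
  let f : (Fin K → EuclideanSpace ℝ (Fin n)) → ℝ := fun v => -(∑ j, ‖v j‖ ^ 2) / 2 - C
  have hf : Measurable f := by fun_prop
  have hLm : Measurable L := L.continuous_of_finiteDimensional.measurable
  have : IsProbabilityMeasure ((volume : Measure (Fin K → EuclideanSpace ℝ (Fin n))).withDensity
      (fun v => ENNReal.ofReal (Real.exp (f v)))) := hC ▸ inferInstance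
  -- The trial law: under it the whitened residual `D (z - T z - b)` is standard Gaussian.
  have := isProbabilityMeasure_withDensity_comp_affine volume hf L hdet0 (-D b)
  have hUnorm := fun j => integral_norm_sq_toLpLin P (hU2 j) (hUcov j) (B j)
  have hWnorm := fun j => integral_norm_sq_toLpLin P (hW2 j) (hWcov j) 1
  simp only [Matrix.toLpLin_one, LinearMap.id_apply] at hWnorm
  have hLU : ∀ ω j, (L (h (X ω) + W ω) + -D b) j = Matrix.toLpLin 2 2 (B j) (U ω j) := by
    intro ω j
    have : L (h (X ω) + W ω) + -D b = D (U ω) := by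
      rw [hUdef, map_sub D, ← sub_eq_add_neg]; rfl
    rw [this]; rfl
  have hllr : ∀ ω, f (W ω) - (f (L (h (X ω) + W ω) + -D b) + Real.log |LinearMap.det L|) =
      (1 / 2) * ∑ j, ‖Matrix.toLpLin 2 2 (B j) (U ω j)‖ ^ 2 - (1 / 2) * ∑ j, ‖W ω j‖ ^ 2
        + (1 / 2) * ∑ j, Real.log (S j).det := fun ω => by
    simp only [f, hLU, hlogdet]
    ring
  have hi1 : Integrable (fun ω => (1 / 2) * ∑ j, ‖Matrix.toLpLin 2 2 (B j) (U ω j)‖ ^ 2) P :=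
    (integrable_finsetSum _ fun j _ => (hUnorm j).1).const_mul _
  have hi2 : Integrable (fun ω => (1 / 2) * ∑ j, ‖W ω j‖ ^ 2) P :=
    (integrable_finsetSum _ fun j _ => (hWnorm j).1).const_mul _
  have hi3 : Integrable (fun ω => (1 / 2) * ∑ j, ‖Matrix.toLpLin 2 2 (B j) (U ω j)‖ ^ 2 -
      (1 / 2) * ∑ j, ‖W ω j‖ ^ 2) P := hi1.sub hi2
  have hi4 : Integrable (fun ω => (1 / 2) * ∑ j, ‖Matrix.toLpLin 2 2 (B j) (U ω j)‖ ^ 2 -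
      (1 / 2) * ∑ j, ‖W ω j‖ ^ 2 + (1 / 2) * ∑ j, Real.log (S j).det) P :=
    hi3.add (integrable_const _)
  have key := mutualInfo_add_noise_le P volume hX hW hXW hh hf
    (g := fun v => f (L v + -D b) + Real.log |LinearMap.det L|) (by fun_prop)
    (hlaw.trans hC) (by simpa only [hllr] using hi4)
  refine ⟨key.1, key.2.trans_eq ?_⟩
  simp only [hllr]
  rw [integral_add hi3 (integrable_const _), integral_sub hi1 hi2, integral_const_mul,
    integral_const_mul, integral_finsetSum _ fun j _ => (hUnorm j).1,
    integral_finsetSum _ fun j _ => (hWnorm j).1]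
  -- Both sums of expected squared norms equal `K * n`, so they cancel.
  simp [hUnorm, hWnorm, hBtr]

end InnovationsChannel

/-! ### Classes in `L²` and second moments of Gaussian noise. -/

namespace InnovationsChannel

variable {Ω : Type*} [MeasurableSpace Ω]

section toL2

variable {P : Measure Ω}

theorem toL2_eq {f : Ω → ℝ} (hf : MemLp f 2 P) : toL2 P f = hf.toLp f := dif_pos hf

theorem coeFn_toL2 {f : Ω → ℝ} (hf : MemLp f 2 P) : toL2 P f =ᵐ[P] f := by
  rw [toL2_eq hf]; exact hf.coeFn_toLp

theorem toL2_add {f g : Ω → ℝ} (hf : MemLp f 2 P) (hg : MemLp g 2 P) :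
    toL2 P (fun ω => f ω + g ω) = toL2 P f + toL2 P g := by
  rw [toL2_eq hf, toL2_eq hg, toL2_eq (f := fun ω => f ω + g ω) (hf.add hg)]; rfl

theorem toL2_sub {f g : Ω → ℝ} (hf : MemLp f 2 P) (hg : MemLp g 2 P) :
    toL2 P (fun ω => f ω - g ω) = toL2 P f - toL2 P g := by
  rw [toL2_eq hf, toL2_eq hg, toL2_eq (f := fun ω => f ω - g ω) (hf.sub hg)]; rfl

theorem toL2_const_mul (c : ℝ) {f : Ω → ℝ} (hf : MemLp f 2 P) :
    toL2 P (fun ω => c * f ω) = c • toL2 P f := by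
  rw [toL2_eq hf, toL2_eq (hf.const_mul c)]; rfl

theorem toL2_sum {ι : Type*} (s : Finset ι) {f : ι → Ω → ℝ} (hf : ∀ i, MemLp (f i) 2 P) :
    toL2 P (fun ω => ∑ i ∈ s, f i ω) = ∑ i ∈ s, toL2 P (f i) := by
  classical
  induction s using Finset.induction_on with
  | empty =>
    simp only [Finset.sum_empty]
    rw [toL2_eq MemLp.zero']; rfl
  | insert a s ha ih =>
    simp only [Finset.sum_insert ha]
    rw [toL2_add (hf a) (memLp_finsetSum s fun i _ => hf i), ih]

theorem inner_toL2 {f g : Ω → ℝ} (hf : MemLp f 2 P) (hg : MemLp g 2 P) :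
    inner ℝ (toL2 P f) (toL2 P g) = ∫ ω, f ω * g ω ∂P := by
  rw [L2.inner_def]
  refine integral_congr_ae ?_
  filter_upwards [coeFn_toL2 hf, coeFn_toL2 hg] with ω h1 h2
  simp [h1, h2, mul_comm]

end toL2

theorem memLp_coord {n : ℕ} {P : Measure Ω} {U : Ω → EuclideanSpace ℝ (Fin n)}
    (hU : MemLp U 2 P) (i : Fin n) : MemLp (fun ω => U ω i) 2 P :=
  (EuclideanSpace.proj (𝕜 := ℝ) i).comp_memLp' hU

section stdGaussian

variable {n : ℕ} {P : Measure Ω} {U : Ω → EuclideanSpace ℝ (Fin n)}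

theorem memLp_of_hasLaw_stdGaussian
    (hU : HasLaw U (stdGaussian (EuclideanSpace ℝ (Fin n))) P) : MemLp U 2 P := by
  have h : MemLp id 2 (P.map U) := hU.map_eq ▸ IsGaussian.memLp_two_id
  exact (memLp_map_measure_iff aestronglyMeasurable_id hU.aemeasurable).1 h

theorem integral_coord_of_hasLaw_stdGaussian
    (hU : HasLaw U (stdGaussian (EuclideanSpace ℝ (Fin n))) P) (i : Fin n) : ∫ ω, U ω i ∂P = 0 := by
  have h := integral_strongDual_stdGaussian (EuclideanSpace.proj (𝕜 := ℝ) i)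
  rw [← hU.map_eq, integral_map hU.aemeasurable (by fun_prop)] at h
  exact h

theorem integral_coord_mul_coord_of_hasLaw_stdGaussian
    (hU : HasLaw U (stdGaussian (EuclideanSpace ℝ (Fin n))) P) (i i' : Fin n) :
    ∫ ω, U ω i * U ω i' ∂P = (1 : Matrix (Fin n) (Fin n) ℝ) i i' := by
  have h := covarianceBilin_apply
    (IsGaussian.memLp_two_id (μ := stdGaussian (EuclideanSpace ℝ (Fin n))))
    (EuclideanSpace.single i 1) (EuclideanSpace.single i' 1)
  rw [covarianceBilin_stdGaussian] at h
  change inner ℝ (_ : EuclideanSpace ℝ (Fin n)) _ = _ at h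
  simp only [id, integral_id_stdGaussian, sub_zero] at h
  rw [← hU.map_eq, integral_map hU.aemeasurable (by fun_prop)] at h
  simpa [Matrix.one_apply, EuclideanSpace.inner_single_left] using h.symm

end stdGaussian

end InnovationsChannel

/-! ### The channel, its innovations and their covariance. -/

namespace InnovationsChannel

variable {Ω : Type*} [MeasurableSpace Ω]

/-- A square-integrable input process and an independent white standard Gaussian noise. -/
structure IsGaussianChannel {n : ℕ} (P : Measure Ω)
    (x w : ℕ → Ω → EuclideanSpace ℝ (Fin n)) : Prop where
  measurable_input : ∀ k, Measurable (x k)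
  memLp_input : ∀ k, MemLp (x k) 2 P
  measurable_noise : ∀ k, Measurable (w k)
  hasLaw_noise : ∀ k, HasLaw (w k) (stdGaussian (EuclideanSpace ℝ (Fin n))) P
  iIndepFun_noise : iIndepFun w P
  indepFun : IndepFun (fun ω k => x k ω) (fun ω k => w k ω) P

namespace IsGaussianChannel

variable {n : ℕ} {P : Measure Ω} {ρ : ℝ}
  {x w : ℕ → Ω → EuclideanSpace ℝ (Fin n)}

theorem memLp_input_coord (hc : IsGaussianChannel P x w) (k : ℕ) (i : Fin n) :
    MemLp (fun ω => x k ω i) 2 P :=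
  memLp_coord (hc.memLp_input k) i

theorem memLp_noise_coord (hc : IsGaussianChannel P x w) (k : ℕ) (i : Fin n) :
    MemLp (fun ω => w k ω i) 2 P :=
  memLp_coord (memLp_of_hasLaw_stdGaussian (hc.hasLaw_noise k)) i

theorem memLp_output_coord (hc : IsGaussianChannel P x w) (k : ℕ) (i : Fin n) :
    MemLp (fun ω => output ρ x w k ω i) 2 P :=
  ((hc.memLp_input_coord k i).const_mul (√ρ)).add (hc.memLp_noise_coord k i)

theorem toL2_output (hc : IsGaussianChannel P x w) (k : ℕ) (i : Fin n) :
    toL2 P (fun ω => output ρ x w k ω i) =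
      √ρ • toL2 P (fun ω => x k ω i) + toL2 P (fun ω => w k ω i) := by
  rw [← toL2_const_mul _ (hc.memLp_input_coord k i),
    ← toL2_add ((hc.memLp_input_coord k i).const_mul _) (hc.memLp_noise_coord k i)]
  rfl

theorem inner_noise_noise (hc : IsGaussianChannel P x w) (k : ℕ) (i i' : Fin n) :
    inner ℝ (toL2 P (fun ω => w k ω i)) (toL2 P (fun ω => w k ω i')) =
      (1 : Matrix (Fin n) (Fin n) ℝ) i i' := by
  rw [inner_toL2 (hc.memLp_noise_coord k i) (hc.memLp_noise_coord k i')]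
  exact integral_coord_mul_coord_of_hasLaw_stdGaussian (hc.hasLaw_noise k) i i'

theorem inner_toL2_noise_eq_zero (hc : IsGaussianChannel P x w) {f : Ω → ℝ} (hf : MemLp f 2 P)
    (k : ℕ) (i : Fin n) (h : IndepFun f (fun ω => w k ω i) P) :
    inner ℝ (toL2 P f) (toL2 P (fun ω => w k ω i)) = 0 := by
  rw [inner_toL2 hf (hc.memLp_noise_coord k i),
    h.integral_fun_mul_eq_mul_integral hf.aestronglyMeasurable
      (hc.memLp_noise_coord k i).aestronglyMeasurable,
    integral_coord_of_hasLaw_stdGaussian (hc.hasLaw_noise k), mul_zero]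

theorem inner_input_noise (hc : IsGaussianChannel P x w) (l k : ℕ) (i i' : Fin n) :
    inner ℝ (toL2 P (fun ω => x l ω i)) (toL2 P (fun ω => w k ω i')) = 0 :=
  hc.inner_toL2_noise_eq_zero (hc.memLp_input_coord l i) k i' <|
    hc.indepFun.comp (φ := fun v : ℕ → EuclideanSpace ℝ (Fin n) => v l i)
      (ψ := fun v : ℕ → EuclideanSpace ℝ (Fin n) => v k i') (by fun_prop) (by fun_prop)

/-- The current noise is centred and independent of constants, inputs and earlier noises, and these
generate the past observations. -/
theorem inner_pastSpace_noise [IsProbabilityMeasure P]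
    (hc : IsGaussianChannel P x w) (k : ℕ) (i : Fin n)
    {y : Lp ℝ 2 P} (hy : y ∈ pastSpace P (output ρ x w) k) :
    inner ℝ y (toL2 P (fun ω => w k ω i)) = 0 := by
  induction hy using Submodule.span_induction with
  | mem y hy =>
    obtain ⟨o | ⟨l, i'⟩, rfl⟩ := hy
    · exact hc.inner_toL2_noise_eq_zero (memLp_const 1) k i (indepFun_const_left 1 _)
    · have hl : (l : ℕ) ≠ k := l.2.ne
      simp only [pastObservations]
      rw [hc.toL2_output, inner_add_left, real_inner_smul_left, hc.inner_input_noise,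
        hc.inner_toL2_noise_eq_zero (hc.memLp_noise_coord l i') k i, mul_zero, add_zero]
      exact (hc.iIndepFun_noise.indepFun hl).comp (φ := fun v => v i') (ψ := fun v => v i)
        (by fun_prop) (by fun_prop)
  | zero => exact inner_zero_left _
  | add a b _ _ ha hb => rw [inner_add_left, ha, hb, add_zero]
  | smul c a _ ha => rw [real_inner_smul_left, ha, mul_zero]

/-- The one-step prediction error of the input, in `L²`. -/
noncomputable def predictionError (P : Measure Ω) (ρ : ℝ)
    (x w : ℕ → Ω → EuclideanSpace ℝ (Fin n)) (k : ℕ) (i : Fin n) : Lp ℝ 2 P :=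
  toL2 P (fun ω => x k ω i) - prediction P x (output ρ x w) k i

/-- Viewing the covariance as a Gram matrix in `L²` makes it positive semidefinite and reduces
covariance computations to inner products. -/
theorem predictionErrorCov_eq_gram (hc : IsGaussianChannel P x w) (k : ℕ) :
    predictionErrorCov P x (output ρ x w) k = Matrix.gram ℝ (predictionError P ρ x w k) := by
  ext i i'
  simp only [predictionErrorCov, Matrix.of_apply, Matrix.gram_apply, L2.inner_def]
  refine integral_congr_ae ?_
  filter_upwards [Lp.coeFn_sub (toL2 P (fun ω => x k ω i)) (prediction P x (output ρ x w) k i),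
    Lp.coeFn_sub (toL2 P (fun ω => x k ω i')) (prediction P x (output ρ x w) k i'),
    coeFn_toL2 (hc.memLp_input_coord k i), coeFn_toL2 (hc.memLp_input_coord k i')]
    with ω h1 h2 h3 h4
  simp only [predictionError, h1, h2, Pi.sub_apply, h3, h4]
  simp [mul_comm]

theorem posSemidef_predictionErrorCov (hc : IsGaussianChannel P x w) (k : ℕ) :
    (predictionErrorCov P x (output ρ x w) k).PosSemidef := by
  rw [hc.predictionErrorCov_eq_gram]
  exact Matrix.posSemidef_gram ℝ _

theorem posDef_one_add_smul (hc : IsGaussianChannel P x w) (hρ : 0 ≤ ρ) (k : ℕ) :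
    (1 + ρ • predictionErrorCov P x (output ρ x w) k).PosDef :=
  Matrix.PosDef.one.add_posSemidef ((hc.posSemidef_predictionErrorCov k).smul hρ)

theorem inner_predictionError_noise [IsProbabilityMeasure P]
    (hc : IsGaussianChannel P x w) (k : ℕ) (i i' : Fin n) :
    inner ℝ (predictionError P ρ x w k i) (toL2 P (fun ω => w k ω i')) = 0 := by
  rw [predictionError, prediction, inner_sub_left, hc.inner_input_noise,
    hc.inner_pastSpace_noise k i' (Submodule.starProjection_apply_mem _ _), sub_zero]

/-- The innovation `z_k - √ρ x̂_{k|k-1}` has covariance `1 + ρ M_k`. -/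
theorem inner_innovation [IsProbabilityMeasure P]
    (hc : IsGaussianChannel P x w) (hρ : 0 ≤ ρ) (k : ℕ) (i i' : Fin n) :
    inner ℝ
      (toL2 P (fun ω => output ρ x w k ω i) - √ρ • prediction P x (output ρ x w) k i)
      (toL2 P (fun ω => output ρ x w k ω i') - √ρ • prediction P x (output ρ x w) k i') =
      (1 + ρ • predictionErrorCov P x (output ρ x w) k) i i' := by
  have h : ∀ i, toL2 P (fun ω => output ρ x w k ω i) -
      √ρ • prediction P x (output ρ x w) k i =
      √ρ • predictionError P ρ x w k i + toL2 P (fun ω => w k ω i) := fun i => by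
    rw [hc.toL2_output, predictionError, smul_sub]; abel
  rw [h, h, inner_add_left, inner_add_right, inner_add_right, real_inner_smul_left,
    real_inner_smul_left, real_inner_smul_right, real_inner_smul_right,
    real_inner_comm, real_inner_comm (predictionError P ρ x w k i'),
    hc.inner_predictionError_noise, hc.inner_predictionError_noise, hc.inner_noise_noise,
    hc.predictionErrorCov_eq_gram, Matrix.add_apply, Matrix.smul_apply, Matrix.gram_apply,
    ← mul_assoc, Real.mul_self_sqrt hρ, smul_eq_mul, real_inner_comm]
  ring

/-- The prediction is only an `L²` class; its coefficients turn it into an affine function of the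
output values, as the trial law requires. -/
theorem exists_prediction_coeff (P : Measure Ω) (x z : ℕ → Ω → EuclideanSpace ℝ (Fin n)) (k : ℕ)
    (i : Fin n) : ∃ c : Option (Fin k × Fin n) → ℝ,
      ∑ o, c o • pastObservations P z k o = prediction P x z k i :=
  (Submodule.mem_span_range_iff_exists_fun ℝ).1 (Submodule.starProjection_apply_mem _ _)

/-- The linear map that sends `z` to `√ρ` times the linear part of the predictor of the input
from the past components of `z`, with coefficients `c`. -/
noncomputable def predictorLinear (K : ℕ) (ρ : ℝ)
    (c : (k : ℕ) → Fin n → Option (Fin k × Fin n) → ℝ) :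
    Module.End ℝ (Fin K → EuclideanSpace ℝ (Fin n)) where
  toFun z j := WithLp.toLp 2 fun i =>
    √ρ * ∑ p : Fin j × Fin n, c j i (some p) * z (p.1.castLE j.2.le) p.2
  map_add' z z' := by
    ext j i
    simp [mul_add, Finset.sum_add_distrib]
  map_smul' a z := by
    ext j i
    simp only [Pi.smul_apply, PiLp.smul_apply, smul_eq_mul, RingHom.id_apply, Finset.mul_sum]
    refine Finset.sum_congr rfl fun p _ => by ring

theorem predictorLinear_causal {K : ℕ} (ρ : ℝ)
    (c : (k : ℕ) → Fin n → Option (Fin k × Fin n) → ℝ)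
    (z : Fin K → EuclideanSpace ℝ (Fin n)) (j : Fin K) (hz : ∀ l < j, z l = 0) :
    predictorLinear K ρ c z j = 0 := by
  ext i
  simp only [predictorLinear, LinearMap.coe_mk, AddHom.coe_mk, PiLp.zero_apply]
  rw [Finset.sum_eq_zero, mul_zero]
  intro p _
  rw [hz _ (Fin.lt_def.2 p.1.2), PiLp.zero_apply, mul_zero]

theorem mutualInfo_block_le [IsProbabilityMeasure P]
    (hc : IsGaussianChannel P x w) (hρ : 0 ≤ ρ) (k : ℕ) :
    mutualInfo P (block x k) (block (output ρ x w) k) ≠ ⊤ ∧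
      (mutualInfo P (block x k) (block (output ρ x w) k)).toReal ≤
        (1 / 2) * ∑ j ∈ Finset.range (k + 1),
          Real.log (1 + ρ • predictionErrorCov P x (output ρ x w) j).det := by
  choose c hcoeff using fun j i => exists_prediction_coeff P x (output ρ x w) j i
  have hpast : ∀ (j : ℕ) (o : Option (Fin j × Fin n)),
      MemLp (fun ω => o.elim (1 : ℝ) fun p => output ρ x w p.1 ω p.2) 2 P ∧
      toL2 P (fun ω => o.elim (1 : ℝ) fun p => output ρ x w p.1 ω p.2) =
        pastObservations P (output ρ x w) j o := by
    rintro j (_ | p)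
    · exact ⟨memLp_const 1, rfl⟩
    · exact ⟨hc.memLp_output_coord _ _, rfl⟩
  let T := predictorLinear (n := n) (k + 1) ρ c
  -- The index `none` carries the constant `1`, so its coefficient is the affine shift.
  let b : Fin (k + 1) → EuclideanSpace ℝ (Fin n) := fun j =>
    WithLp.toLp 2 fun i => √ρ * c j i none
  let U : Ω → Fin (k + 1) → EuclideanSpace ℝ (Fin n) := fun ω =>
    block (output ρ x w) k ω - T (block (output ρ x w) k ω) - b
  have hU : ∀ j i, (fun ω => U ω j i) = fun ω => output ρ x w j ω i - √ρ * ∑ o, c j i o *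
      o.elim (1 : ℝ) fun p => output ρ x w p.1 ω p.2 := fun j i => by
    ext ω
    simp only [U, T, b, predictorLinear, Pi.sub_apply, PiLp.sub_apply, LinearMap.coe_mk,
      AddHom.coe_mk, block, Fintype.sum_option, Option.elim, Fin.val_castLE]
    ring
  have hsum : ∀ j i, MemLp (fun ω => ∑ o, c j i o *
      o.elim (1 : ℝ) fun p => output ρ x w p.1 ω p.2) 2 P := fun j i =>
    memLp_finsetSum _ fun o _ => (hpast j o).1.const_mul _
  have hU2 : ∀ j i, MemLp (fun ω => U ω j i) 2 P := fun j i => by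
    rw [hU]
    exact (hc.memLp_output_coord j i).sub ((hsum j i).const_mul _)
  -- The pointwise residual `U` represents the innovation in `L²`, so its covariance is known.
  have hUL2 : ∀ j i, toL2 P (fun ω => U ω j i) =
      toL2 P (fun ω => output ρ x w j ω i) - √ρ • prediction P x (output ρ x w) j i := by
    intro j i
    rw [hU, toL2_sub (hc.memLp_output_coord j i) ((hsum j i).const_mul _),
      toL2_const_mul _ (hsum j i), toL2_sum _ (fun o => (hpast j o).1.const_mul _), ← hcoeff]
    congr 2
    exact Finset.sum_congr rfl fun o _ => by rw [toL2_const_mul _ (hpast j o).1, (hpast j o).2]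
  have hUcov : ∀ (j : Fin (k + 1)) i i', ∫ ω, U ω j i * U ω j i' ∂P =
      (1 + ρ • predictionErrorCov P x (output ρ x w) j) i i' := fun j i i' => by
    rw [← inner_toL2 (hU2 j i) (hU2 j i'), hUL2, hUL2, hc.inner_innovation hρ]
  have hlaw : P.map (block w k) =
      Measure.pi (fun _ => stdGaussian (EuclideanSpace ℝ (Fin n))) := by
    have h := (iIndepFun_iff_map_fun_eq_pi_map fun j : Fin (k + 1) =>
      (hc.measurable_noise j).aemeasurable).1
        (hc.iIndepFun_noise.precomp (g := fun j : Fin (k + 1) => (j : ℕ)) Fin.val_injective)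
    simp only [(hc.hasLaw_noise _).map_eq] at h
    exact h
  have hmeas : ∀ {y : ℕ → Ω → EuclideanSpace ℝ (Fin n)}, (∀ j, Measurable (y j)) →
      Measurable (block y k) := fun hy => measurable_pi_lambda _ fun j => hy j
  have hindep : IndepFun (block x k) (block w k) P :=
    hc.indepFun.comp
      (φ := fun (v : ℕ → EuclideanSpace ℝ (Fin n)) (j : Fin (k + 1)) => v j)
      (ψ := fun (v : ℕ → EuclideanSpace ℝ (Fin n)) (j : Fin (k + 1)) => v j)
      (by fun_prop) (by fun_prop)
  have key := mutualInfo_le_sum_log_det P (hmeas hc.measurable_input)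
    (hmeas hc.measurable_noise) hindep hlaw (fun j i => hc.memLp_noise_coord j i)
    (fun j i i' => integral_coord_mul_coord_of_hasLaw_stdGaussian (hc.hasLaw_noise j) i i')
    (h := fun v => √ρ • v) (by fun_prop) T (predictorLinear_causal ρ c) b
    (S := fun j => 1 + ρ • predictionErrorCov P x (output ρ x w) j)
    (fun j => hc.posDef_one_add_smul hρ j) (U := U) (fun ω => rfl) hU2 hUcov
  rw [Finset.sum_range]
  exact key

end IsGaussianChannel

end InnovationsChannel

/-! ### Conclusion. -/

theorem proposition8 {Ω : Type*} [MeasurableSpace Ω] (P : Measure Ω) [IsProbabilityMeasure P]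
    (n : ℕ) (ρ : ℝ) (hρ : 0 ≤ ρ)
    (x w : ℕ → Ω → EuclideanSpace ℝ (Fin n))
    (hx_meas : ∀ k, Measurable (x k)) (hx_sq : ∀ k, MemLp (x k) 2 P)
    (hw_meas : ∀ k, Measurable (w k))
    (hw_law : ∀ k, HasLaw (w k) (stdGaussian (EuclideanSpace ℝ (Fin n))) P)
    (hw_indep : iIndepFun w P)
    (hxw : IndepFun (fun ω k => x k ω) (fun ω k => w k ω) P)
    (M : ℕ → Matrix (Fin n) (Fin n) ℝ)
    (hM : ∀ j, M j = InnovationsChannel.predictionErrorCov P x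
      (InnovationsChannel.output ρ x w) j) :
    (∀ j, 0 < (1 + ρ • M j).det ∧ Real.log (1 + ρ • M j).det ≤ ρ * (M j).trace) ∧
    ∀ k : ℕ,
      InnovationsChannel.mutualInfo P (InnovationsChannel.block x k)
        (InnovationsChannel.block (InnovationsChannel.output ρ x w) k) ≠ ⊤ ∧
      (InnovationsChannel.mutualInfo P (InnovationsChannel.block x k)
        (InnovationsChannel.block (InnovationsChannel.output ρ x w) k)).toReal
          ≤ (1 / 2) * ∑ j ∈ Finset.range (k + 1), Real.log (1 + ρ • M j).det ∧
      (1 / 2) * ∑ j ∈ Finset.range (k + 1), Real.log (1 + ρ • M j).det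
          ≤ (ρ / 2) * ∑ j ∈ Finset.range (k + 1), (M j).trace := by
  have hc : InnovationsChannel.IsGaussianChannel P x w :=
    ⟨hx_meas, hx_sq, hw_meas, hw_law, hw_indep, hxw⟩
  have hpos : ∀ j, (1 + ρ • M j).PosDef := fun j => hM j ▸ hc.posDef_one_add_smul hρ j
  have hlog : ∀ j, Real.log (1 + ρ • M j).det ≤ ρ * (M j).trace := fun j => by
    have h := (hpos j).log_det_le_trace_sub_card
    rw [Matrix.trace_add, Matrix.trace_one, Matrix.trace_smul, smul_eq_mul] at h
    linarith
  refine ⟨fun j => ⟨(hpos j).det_pos, hlog j⟩, fun k => ?_⟩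
  have hk := hc.mutualInfo_block_le hρ k
  simp only [← hM] at hk
  refine ⟨hk.1, hk.2, ?_⟩
  have hsum := Finset.sum_le_sum fun j (_ : j ∈ Finset.range (k + 1)) => hlog j
  rw [← Finset.mul_sum] at hsum
  linarith
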